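/- Let $d\ge 1$, and write $\ell_d$ for Lebesgue measure on $\mathbb{R}^d$. For a compact convex set $W\subset\mathbb{R}^d$ with $\ell_d(W)=1$ and $t>0$ let $\eta_t$ be a Poisson point process on $\mathbb{R}^d$ with intensity measure $t\,\ell_d(\,\cdot\cap W)$. For $\delta>0$ the Gilbert graph has the points of $\eta_t$ as vertices, and an edge between two distinct points $x,y\in\eta_t$ if and only if $\|x-y\|\le\delta$. Its number of edges is $$N_t=N_t(W,\delta)=\frac12\sum_{(x,y)\in\eta_{t,\neq}^2}\mathbf 1(\|x-y\|\le \delta).$$ **Theorem.** (i) Let $(\delta_t)_{t>0}$ be positive real numbers with $\delta_t\to0$ and such that $t\delta_t^d$ converges to a (finite) constant as $t\to\infty$. Then there is a constant $c>0$, depending only on $d$ and the family $(\delta_t)_{t>0}$, such that for all $W$ as above, all $t>0$, every median $m$ of $N_t=N_t(W,\delta_t)$ and all real $u$ with $\frac{u}{\sqrt{u+m}}\ge c$, $$\mathbb P(|N_t-m|\ge u)\le 4\,t\,\ell_d(W)\exp\Big(-\frac1{16}\,\frac{u}{\sqrt{u+m}}\Big).$$ (ii) The constant can be chosen to depend only on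 $d$ and on a bound for $t\delta_t^d$: for every real $K$ there is a constant $c=c(d,K)>0$ such that the same inequality holds for $N_t(W,\delta)$ for all $W$ as above, all $t>0$ and $\delta>0$ with $t\delta^d\le K$, every median $m$ of $N_t(W,\delta)$ and all real $u$ with $\frac{u}{\sqrt{u+m}}\ge c$. -/

import Mathlib

open MeasureTheory ProbabilityTheory Filter Topology

/-- `η : Ω → Set X` is a Poisson point process on `X` with (locally finite, non-atomic) intensity
measure `μ`: a random point configuration such that

* for every measurable `B`, the number of points of `η` in `B` is a random variable;
* for every measurable `B` with `μ B < ∞`, this number is Poisson distributed with mean `μ B`;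
* the numbers of points in finitely many pairwise disjoint measurable sets are independent.

As the intensity has no atoms, the process is simple, so that its realizations are sets of points
(rather than counting measures with multiplicities). -/
structure IsPoissonPointProcess {Ω X : Type*} [MeasurableSpace Ω] [MeasurableSpace X]
    (P : Measure Ω) (η : Ω → Set X) (μ : Measure X) : Prop where
  measurable_count : ∀ B : Set X, MeasurableSet B → Measurable (fun ω => (η ω ∩ B).encard)
  law_count : ∀ B : Set X, MeasurableSet B → μ B ≠ ⊤ →
    HasLaw (fun ω => (η ω ∩ B).encard)
      ((poissonMeasure (μ B).toNNReal).map (Nat.cast : ℕ → ℕ∞)) P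
  indep_count : ∀ (n : ℕ) (B : Fin n → Set X), (∀ i, MeasurableSet (B i)) →
    Pairwise (fun i j => Disjoint (B i) (B j)) →
    iIndepFun (fun i ω => (η ω ∩ B i).encard) P

/-- The Gilbert graph (random geometric graph) of a point configuration `S`: its vertices are the
points of `S`, and two distinct points are joined by an edge iff their distance is at most `r`. -/
def gilbertGraph {E : Type*} [NormedAddCommGroup E] (S : Set E) (r : ℝ) : SimpleGraph S where
  Adj x y := x ≠ y ∧ ‖(x : E) - (y : E)‖ ≤ r
  symm := ⟨fun x y h => ⟨h.1.symm, by rw [norm_sub_rev]; exact h.2⟩⟩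
  loopless := ⟨fun _ h => h.1 rfl⟩

/-- The number of edges of the Gilbert graph of the configuration `S`. -/
noncomputable def gilbertEdgeCount {E : Type*} [NormedAddCommGroup E] (S : Set E) (r : ℝ) : ℕ :=
  (gilbertGraph S r).edgeSet.ncard

/-- The number of edges is one half of the number of ordered pairs of distinct points of the
configuration at distance at most `r`. -/
theorem two_mul_gilbertEdgeCount {E : Type*} [NormedAddCommGroup E] (S : Set E) (hS : S.Finite)
    (r : ℝ) :
    2 * gilbertEdgeCount S r
      = {p : E × E | p.1 ∈ S ∧ p.2 ∈ S ∧ p.1 ≠ p.2 ∧ ‖p.1 - p.2‖ ≤ r}.ncard := by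
  classical
  have : Fintype S := hS.fintype
  have h1 : gilbertEdgeCount S r = (gilbertGraph S r).edgeFinset.card := by
    rw [gilbertEdgeCount, ← SimpleGraph.coe_edgeFinset, Set.ncard_coe_finset]
  rw [h1, ← SimpleGraph.dart_card_eq_twice_card_edges, ← Nat.card_eq_fintype_card,
    ← Nat.card_coe_set_eq]
  refine Nat.card_congr
    { toFun := fun e => ⟨((e.fst : E), (e.snd : E)), e.fst.2, e.snd.2,
        fun h => e.adj.1 (Subtype.ext h), e.adj.2⟩
      invFun := fun p => ⟨(⟨p.1.1, p.2.1⟩, ⟨p.1.2, p.2.2.1⟩),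
        fun h => p.2.2.2.1 (congrArg Subtype.val h), p.2.2.2.2⟩
      left_inv := fun e => rfl
      right_inv := fun p => rfl }

/-- `m` is a median of the real random variable `X`. -/
def IsMedian {Ω : Type*} [MeasurableSpace Ω] (P : Measure Ω) (X : Ω → ℝ) (m : ℝ) : Prop :=
  1 / 2 ≤ P.real {ω | X ω ≤ m} ∧ 1 / 2 ≤ P.real {ω | m ≤ X ω}

/-! The engine is Talagrand's convex distance inequality for independent occupation variables.
Passing from a configuration to another loses at most the sum of the degrees of the points that are
not shared, and if all degrees are at most `D`, the squared degrees sum to at most `2 * D` times the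
edge count. So the probability of at most `a` edges, times that of at least `b` edges with all
degrees at most `D`, is at most `exp (-(b - a)² / (16 D b))` (`prodWeight_pairSum_le`). Ever finer
Voronoi partitions, whose cells eventually separate the points of a finite configuration, carry this
to the Poisson process (`gilbertEdgeCount_mul_le`). It is used with `a` or `b` equal to the median.

Put `x = u / √(u + m)`. A degree above `3 ^ d * k` forces some cube of side `δ` to hold more than
`k` points, which has probability at most `t * L ^ k / k!`, where `L` bounds the mean number of
points per cube (`measure_exists_cell_le`). If `3 ^ d * k` is of order `x` but at most `x / 2`,
Talagrand's term is `exp (-x / 8)` and, for large `x`, the factorial term is below `exp (-x / 16)`.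
The prefactor absorbs the remaining constants when `t ≥ 1`. When `t` is bounded, a deviation of size
`u ≥ x²` already needs at least `x` points, and the Poisson tail of the total number of points
suffices, whatever the radius. -/

/-! ### Talagrand's convex distance inequality on finite product spaces -/

/-- The probability of a finite event under a product of finitely supported weights. -/
noncomputable def prodWeight {α : Type*} {n : ℕ} (w : Fin n → α → ℝ) (A : Finset (Fin n → α)) : ℝ :=
  ∑ x ∈ A, ∏ i, w i (x i)

/-- `s` dominates the Hamming distance from `x` to `A` in every nonnegative weighting of the
coordinates; such an `s` represents a point of the convex hull appearing in Talagrand's convex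
distance. -/
def ConvexDominates {α : Type*} [DecidableEq α] {n : ℕ} (A : Finset (Fin n → α)) (x : Fin n → α)
    (s : Fin n → ℝ) : Prop :=
  ∀ v : Fin n → ℝ, (∀ i, 0 ≤ v i) →
    ∃ y ∈ A, ∑ i, v i * (if x i = y i then 0 else 1) ≤ ∑ i, v i * s i

/-- The scalar inequality behind Talagrand's induction, at the interpolation weight `μ = 2 * (1 -
r)`. This simple choice stands in for the minimiser `-4 * log r`, and it stays in `[0, 1]` exactly
because `r ≥ 1 / 2`. -/
theorem exp_talagrand_le {r : ℝ} (h1 : 1 / 2 ≤ r) (h2 : r ≤ 1) :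
    Real.exp ((2 * (1 - r)) ^ 2 / 8 - (1 - 2 * (1 - r)) * Real.log r) ≤ 2 - r := by
  obtain ⟨ρ, rfl⟩ : ∃ ρ, r = 1 - ρ := ⟨1 - r, by ring⟩
  have hρ0 : 0 ≤ ρ := by linarith
  have hρ1 : ρ ≤ 1 / 2 := by linarith
  have hl : -(ρ + ρ ^ 2) ≤ Real.log (1 - ρ) := by
    rw [Real.le_log_iff_exp_le (by linarith), Real.exp_neg]
    apply inv_le_of_inv_le₀ (by linarith)
    have h3 := Real.quadratic_le_exp_of_nonneg (show 0 ≤ ρ + ρ ^ 2 by positivity)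
    refine le_trans ?_ h3
    rw [inv_le_iff_one_le_mul₀ (by linarith)]
    have e : (1 + (ρ + ρ ^ 2) + (ρ + ρ ^ 2) ^ 2 / 2) * (1 - ρ)
        = 1 + ρ ^ 2 / 2 * (1 - ρ - ρ ^ 2 - ρ ^ 3) := by ring
    have h4 : ρ ^ 2 ≤ 1 / 4 := by nlinarith
    have h5 : ρ ^ 3 ≤ 1 / 4 := by nlinarith
    rw [e]
    linarith [mul_nonneg (show 0 ≤ ρ ^ 2 / 2 by positivity)
      (show 0 ≤ 1 - ρ - ρ ^ 2 - ρ ^ 3 by linarith)]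
  have hu : ρ - ρ ^ 2 / 2 ≤ Real.log (1 + ρ) := by
    refine le_trans ?_ (Real.le_log_one_add_of_nonneg hρ0)
    rw [le_div_iff₀ (by linarith)]
    nlinarith [mul_nonneg (sq_nonneg ρ) hρ0]
  rw [show (2 : ℝ) - (1 - ρ) = 1 + ρ by ring, ← Real.le_log_iff_exp_le (by linarith)]
  refine le_trans ?_ hu
  have := mul_le_mul_of_nonneg_left hl (show 0 ≤ 1 - 2 * ρ by linarith)
  nlinarith [mul_nonneg (sq_nonneg ρ) hρ0]

theorem exp_one_eighth_le : Real.exp (1 / 8) ≤ 3 / 2 := by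
  have h : Real.exp (1 / 8) ^ 8 = Real.exp 1 := by rw [← Real.exp_nat_mul]; norm_num
  by_contra! hc
  have := pow_lt_pow_left₀ hc (by norm_num) (n := 8) (by norm_num)
  have := Real.exp_one_lt_d9
  norm_num at *
  linarith

theorem prodWeight_mono {α : Type*} {n : ℕ} {w : Fin n → α → ℝ} (hw : ∀ i a, 0 ≤ w i a)
    {A B : Finset (Fin n → α)} (h : A ⊆ B) : prodWeight w A ≤ prodWeight w B :=
  Finset.sum_le_sum_of_subset_of_nonneg h fun _ _ _ => Finset.prod_nonneg fun _ _ => hw _ _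

theorem prodWeight_nonneg {α : Type*} {n : ℕ} {w : Fin n → α → ℝ} (hw : ∀ i a, 0 ≤ w i a)
    (A : Finset (Fin n → α)) : 0 ≤ prodWeight w A :=
  Finset.sum_nonneg fun _ _ => Finset.prod_nonneg fun _ _ => hw _ _

theorem sum_fin_succ_pi {α : Type*} [Fintype α] {n : ℕ} (f : (Fin (n + 1) → α) → ℝ) :
    ∑ x, f x = ∑ a, ∑ x : Fin n → α, f (Fin.cons a x) := by
  rw [← (Fin.consEquiv (fun _ : Fin (n + 1) => α)).sum_comp, Fintype.sum_prod_type]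
  rfl

section
variable {α : Type*} [Fintype α] [DecidableEq α]

theorem prodWeight_succ {n : ℕ} (w : Fin (n + 1) → α → ℝ) (A : Finset (Fin (n + 1) → α)) :
    prodWeight w A = ∑ a, w 0 a * prodWeight (fun i => w i.succ)
      (Finset.univ.filter fun x : Fin n → α => (Fin.cons a x : Fin (n + 1) → α) ∈ A) := by
  have hA : A = Finset.univ.filter (· ∈ A) := by simp
  rw [prodWeight, hA]
  simp only [prodWeight, Finset.sum_filter, Finset.mul_sum, Finset.mem_filter, Finset.mem_univ,
    true_and]
  rw [sum_fin_succ_pi]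
  refine Finset.sum_congr rfl fun a _ => Finset.sum_congr rfl fun x _ => ?_
  split_ifs <;> simp [Fin.prod_univ_succ]

/-- Convexity of `exp` plays the role of Hölder's inequality: shifting `X` by `log a` and `Y` by
`log b` makes both exponential sums at most one, hence also their convex combination, and the shifts
are collected in the prefactor `Q`. -/
theorem sum_exp_convex_combination_le {ι : Type*} [Fintype ι] {W X Y Z : ι → ℝ} {a b r μ : ℝ}
    (hW : ∀ x, 0 ≤ W x) (ha : 0 < a) (hb : 0 < b) (hr : r = a / b) (h1 : 1 / 2 ≤ r) (h2 : r ≤ 1)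
    (hμ : μ = 2 * (1 - r)) (hX : (∑ x, W x * Real.exp (X x)) * a ≤ 1)
    (hY : (∑ x, W x * Real.exp (Y x)) * b ≤ 1)
    (hZ : ∀ x, Z x ≤ μ ^ 2 / 8 + (1 - μ) * X x + μ * Y x) :
    (∑ x, W x * Real.exp (Z x)) * b ≤ 2 - r := by
  have hμ0 : 0 ≤ μ := by linarith
  have hμ1 : μ ≤ 1 := by linarith
  set Q := Real.exp (μ ^ 2 / 8 - (1 - μ) * Real.log a - μ * Real.log b) with hQ
  have key : ∀ x, W x * Real.exp (Z x) ≤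
      Q * ((1 - μ) * (W x * Real.exp (X x) * a) + μ * (W x * Real.exp (Y x) * b)) := by
    intro x
    have h3 := convexOn_exp.2 (Set.mem_univ (X x + Real.log a)) (Set.mem_univ (Y x + Real.log b))
      (show 0 ≤ 1 - μ by linarith) hμ0 (by ring)
    simp only [smul_eq_mul, Real.exp_add, Real.exp_log ha, Real.exp_log hb] at h3
    have h4 : Real.exp (Z x) ≤
        Q * Real.exp ((1 - μ) * (X x + Real.log a) + μ * (Y x + Real.log b)) := by
      rw [hQ, ← Real.exp_add]
      apply Real.exp_le_exp.2
      linarith [hZ x]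
    calc W x * Real.exp (Z x) ≤ W x * (Q * ((1 - μ) * (Real.exp (X x) * a)
          + μ * (Real.exp (Y x) * b))) := by
          refine mul_le_mul_of_nonneg_left (h4.trans ?_) (hW x)
          rw [Real.exp_add]
          exact mul_le_mul_of_nonneg_left h3 (Real.exp_nonneg _)
      _ = _ := by ring
  have h5 : ∑ x, W x * Real.exp (Z x) ≤ Q := by
    refine (Finset.sum_le_sum fun x _ => key x).trans ?_
    rw [← Finset.mul_sum, Finset.sum_add_distrib, ← Finset.mul_sum, ← Finset.mul_sum,
      ← Finset.sum_mul, ← Finset.sum_mul]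
    refine mul_le_of_le_one_right (Real.exp_nonneg _) ?_
    nlinarith
  calc _ ≤ Q * b := mul_le_mul_of_nonneg_right h5 hb.le
    _ = Real.exp (μ ^ 2 / 8 - (1 - μ) * Real.log r) := by
      rw [hQ, ← Real.exp_log hb, ← Real.exp_add, Real.exp_log hb, hr,
        Real.log_div ha.ne' hb.ne']
      congr 1; ring
    _ ≤ _ := by rw [hμ]; exact exp_talagrand_le h1 h2

theorem sq_convex_combination_le {x y μ : ℝ} (h0 : 0 ≤ μ) (h1 : μ ≤ 1) :
    ((1 - μ) * x + μ * y) ^ 2 ≤ (1 - μ) * x ^ 2 + μ * y ^ 2 := by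
  nlinarith [mul_nonneg (mul_nonneg h0 (sub_nonneg.2 h1)) (sq_nonneg (x - y))]

theorem ConvexDominates.cons_of_projection {n : ℕ} {A : Finset (Fin (n + 1) → α)} {x : Fin n → α}
    {s : Fin n → ℝ} (a : α)
    (h : ConvexDominates (Finset.univ.filter fun y : Fin n → α =>
      ∃ b, (Fin.cons b y : Fin (n + 1) → α) ∈ A) x s) :
    ConvexDominates A (Fin.cons a x) (Fin.cons 1 s) := by
  intro v hv
  obtain ⟨y, hy, hle⟩ := h (fun i => v i.succ) fun i => hv _
  obtain ⟨b, hb⟩ := (Finset.mem_filter.1 hy).2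
  refine ⟨_, hb, ?_⟩
  simp only [Fin.sum_univ_succ, Fin.cons_zero, Fin.cons_succ]
  have : v 0 * (if a = b then 0 else 1) ≤ v 0 * 1 :=
    mul_le_mul_of_nonneg_left (by split_ifs <;> norm_num) (hv 0)
  linarith

/-- The new vector is the convex combination of `(0, s)` and `(1, t)`. For each weighting both have
a witness in `A`, and the smaller of two numbers is at most any weighted average of them. -/
theorem ConvexDominates.cons_of_section {n : ℕ} {A : Finset (Fin (n + 1) → α)} {x : Fin n → α}
    {s t : Fin n → ℝ} {a : α} {μ : ℝ} (h0 : 0 ≤ μ) (h1 : μ ≤ 1)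
    (hs : ConvexDominates (Finset.univ.filter fun y : Fin n → α =>
      (Fin.cons a y : Fin (n + 1) → α) ∈ A) x s)
    (ht : ConvexDominates A (Fin.cons a x) (Fin.cons 1 t)) :
    ConvexDominates A (Fin.cons a x) (Fin.cons μ fun i => (1 - μ) * s i + μ * t i) := by
  intro v hv
  obtain ⟨y, hy, hle⟩ := hs (fun i => v i.succ) fun i => hv _
  obtain ⟨z, hz, hle'⟩ := ht v hv
  have hy' := (Finset.mem_filter.1 hy).2
  have e : ∑ i, v i * (Fin.cons μ fun i => (1 - μ) * s i + μ * t i : Fin (n + 1) → ℝ) i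
      = (1 - μ) * ∑ i, v i.succ * s i
        + μ * ∑ i, v i * (Fin.cons 1 t : Fin (n + 1) → ℝ) i := by
    simp only [Fin.sum_univ_succ, Fin.cons_zero, Fin.cons_succ, mul_add, Finset.sum_add_distrib,
      Finset.mul_sum]
    have e1 : ∀ i : Fin n, v i.succ * ((1 - μ) * s i) = (1 - μ) * (v i.succ * s i) :=
      fun i => by ring
    have e2 : ∀ i : Fin n, v i.succ * (μ * t i) = μ * (v i.succ * t i) := fun i => by ring
    simp only [e1, e2]
    ring
  have e3 : ∑ i, v i * (if (Fin.cons a x : Fin (n + 1) → α) i = (Fin.cons a y : Fin (n + 1) → α) i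
      then (0 : ℝ) else 1) = ∑ i, v i.succ * (if x i = y i then 0 else 1) := by
    simp [Fin.sum_univ_succ]
  rw [e]
  by_contra! hc
  have c1 := hc _ hy'
  have c2 := hc _ hz
  rw [e3] at c1
  have c3 := lt_min (c1.trans_le hle) (c2.trans_le hle')
  have c4 := mul_le_mul_of_nonneg_left
    (min_le_left (∑ i, v i.succ * s i) (∑ i, v i * (Fin.cons 1 t : Fin (n + 1) → ℝ) i))
    (sub_nonneg.2 h1)
  have c5 := mul_le_mul_of_nonneg_left
    (min_le_right (∑ i, v i.succ * s i) (∑ i, v i * (Fin.cons 1 t : Fin (n + 1) → ℝ) i)) h0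
  linarith

/-- **Talagrand's convex distance inequality** for finite product spaces. -/
theorem talagrand_convex_distance (n : ℕ) (w : Fin n → α → ℝ) (hw : ∀ i a, 0 ≤ w i a)
    (hw1 : ∀ i, ∑ a, w i a = 1) (A : Finset (Fin n → α)) (hA : 0 < prodWeight w A) :
    ∃ s : (Fin n → α) → Fin n → ℝ, (∀ x, ConvexDominates A x (s x)) ∧
      (∑ x, (∏ i, w i (x i)) * Real.exp ((∑ i, s x i ^ 2) / 8)) * prodWeight w A ≤ 1 := by
  induction n with
  | zero =>
    refine ⟨0, fun x v _ => ?_, ?_⟩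
    · obtain ⟨y, hy, -⟩ := Finset.exists_ne_zero_of_sum_ne_zero hA.ne'
      exact ⟨y, hy, by simp⟩
    · simp only [Finset.univ_eq_empty, Finset.sum_empty, Finset.prod_empty, prodWeight,
        Finset.sum_const, nsmul_eq_mul]
      have : A.card ≤ 1 := Finset.card_le_one.2 fun a _ b _ => Subsingleton.elim _ _
      simp only [Finset.card_univ, Fintype.card_unique]
      have h : (A.card : ℝ) ≤ 1 := by exact_mod_cast this
      simpa using h
  | succ n ih =>
    set w' : Fin n → α → ℝ := fun i => w i.succ
    have hw' : ∀ i a, 0 ≤ w' i a := fun i => hw _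
    set S : α → Finset (Fin n → α) := fun a =>
      Finset.univ.filter fun x : Fin n → α => (Fin.cons a x : Fin (n + 1) → α) ∈ A with hS
    set B : Finset (Fin n → α) :=
      Finset.univ.filter fun x : Fin n → α => ∃ a, (Fin.cons a x : Fin (n + 1) → α) ∈ A with hB
    have hSB : ∀ a, S a ⊆ B := fun a x hx => by
      simp only [hS, hB, Finset.mem_filter, Finset.mem_univ, true_and] at hx ⊢
      exact ⟨a, hx⟩
    have hAS : prodWeight w A = ∑ a, w 0 a * prodWeight w' (S a) := prodWeight_succ w A
    have hABle : prodWeight w A ≤ prodWeight w' B := by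
      rw [hAS]
      calc _ ≤ ∑ a, w 0 a * prodWeight w' B := Finset.sum_le_sum fun a _ =>
            mul_le_mul_of_nonneg_left (prodWeight_mono hw' (hSB a)) (hw _ _)
        _ = _ := by rw [← Finset.sum_mul, hw1, one_mul]
    have hBpos : 0 < prodWeight w' B := hA.trans_le hABle
    obtain ⟨t, ht, htB⟩ := ih w' hw' (fun i => hw1 _) B hBpos
    have main : ∀ a, ∃ s : (Fin n → α) → Fin (n + 1) → ℝ,
        (∀ x, ConvexDominates A (Fin.cons a x) (s x)) ∧
        (∑ x, (∏ i, w' i (x i)) * Real.exp ((∑ i, s x i ^ 2) / 8)) * prodWeight w' B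
          ≤ 2 - prodWeight w' (S a) / prodWeight w' B := by
      intro a
      have hr1 : prodWeight w' (S a) / prodWeight w' B ≤ 1 :=
        (div_le_one hBpos).2 (prodWeight_mono hw' (hSB a))
      -- A section of less than half the mass of the projection is ignored: changing the first
      -- coordinate costs a factor `exp (1 / 8) ≤ 3 / 2 ≤ 2 - r`. Otherwise section and projection
      -- are interpolated.
      rcases lt_or_ge (prodWeight w' (S a) / prodWeight w' B) (1 / 2) with h | h
      · refine ⟨fun x => Fin.cons 1 (t x), fun x => (ht x).cons_of_projection a, ?_⟩
        simp only [Fin.sum_univ_succ, Fin.cons_zero, Fin.cons_succ, add_div, Real.exp_add]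
        have e : ∀ x : Fin n → α, (∏ i, w' i (x i)) * (Real.exp (1 ^ 2 / 8) *
            Real.exp ((∑ i, t x i ^ 2) / 8)) = Real.exp (1 / 8) * ((∏ i, w' i (x i)) *
            Real.exp ((∑ i, t x i ^ 2) / 8)) := fun x => by rw [one_pow]; ring
        simp only [e]
        rw [← Finset.mul_sum, mul_assoc]
        have := mul_le_mul_of_nonneg_left htB (Real.exp_nonneg (1 / 8))
        linarith [exp_one_eighth_le]
      · set r := prodWeight w' (S a) / prodWeight w' B with hr
        have hapos : 0 < prodWeight w' (S a) := by
          rcases (prodWeight_nonneg hw' (S a)).lt_or_eq with h' | h'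
          · exact h'
          · rw [hr, ← h'] at h; norm_num at h
        obtain ⟨s, hs, hsA⟩ := ih w' hw' (fun i => hw1 _) (S a) hapos
        refine ⟨fun x => Fin.cons (2 * (1 - r)) fun i =>
          (1 - 2 * (1 - r)) * s x i + 2 * (1 - r) * t x i, fun x =>
          ConvexDominates.cons_of_section (by linarith) (by linarith) (hs x)
            ((ht x).cons_of_projection a), ?_⟩
        refine sum_exp_convex_combination_le (fun x => Finset.prod_nonneg fun i _ => hw' _ _)
          hapos hBpos hr h hr1 rfl hsA htB fun x => ?_
        simp only [Fin.sum_univ_succ, Fin.cons_zero, Fin.cons_succ]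
        have : ∑ i, ((1 - 2 * (1 - r)) * s x i + 2 * (1 - r) * t x i) ^ 2 ≤
            (1 - 2 * (1 - r)) * ∑ i, s x i ^ 2 + 2 * (1 - r) * ∑ i, t x i ^ 2 := by
          rw [Finset.mul_sum, Finset.mul_sum, ← Finset.sum_add_distrib]
          exact Finset.sum_le_sum fun i _ =>
            sq_convex_combination_le (by linarith) (by linarith)
        linarith
    choose s hs hsle using main
    refine ⟨fun x => s (x 0) (Fin.tail x), fun x => ?_, ?_⟩
    · simpa using hs (x 0) (Fin.tail x)
    · rw [sum_fin_succ_pi]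
      set b := prodWeight w' B
      have e1 : (∑ a, ∑ x : Fin n → α, (∏ i, w i ((Fin.cons a x : Fin (n + 1) → α) i)) *
          Real.exp ((∑ i, s ((Fin.cons a x : Fin (n + 1) → α) 0)
            (Fin.tail (Fin.cons a x : Fin (n + 1) → α)) i ^ 2) / 8)) * b ≤
          2 - prodWeight w A / b := by
        have e3 : 2 - prodWeight w A / b = ∑ a, w 0 a * (2 - prodWeight w' (S a) / b) := by
          simp only [mul_sub, Finset.sum_sub_distrib, ← Finset.sum_mul, hw1, hAS, Finset.sum_div,
            mul_div_assoc]
          ring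
        rw [e3, Finset.sum_mul]
        refine Finset.sum_le_sum fun a _ => ?_
        have := mul_le_mul_of_nonneg_left (hsle a) (hw 0 a)
        refine le_trans (le_of_eq ?_) this
        simp only [Fin.prod_univ_succ, Fin.cons_zero, Fin.cons_succ, Fin.tail_cons, mul_assoc]
        rw [← Finset.mul_sum, mul_assoc]
      set G := (∑ a, ∑ x : Fin n → α, (∏ i, w i ((Fin.cons a x : Fin (n + 1) → α) i)) *
          Real.exp ((∑ i, s ((Fin.cons a x : Fin (n + 1) → α) 0)
            (Fin.tail (Fin.cons a x : Fin (n + 1) → α)) i ^ 2) / 8))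
      set q := prodWeight w A
      -- The average over the first coordinate gives `G * b ≤ 2 - q / b`, and `y * (2 - y) ≤ 1` at
      -- `y = q / b` closes the induction.
      have e4 : G * q = (G * b) * (q / b) := by field_simp
      have hq : 0 ≤ q / b := by positivity
      rw [e4]
      nlinarith [mul_le_mul_of_nonneg_right e1 hq, sq_nonneg (q / b - 1)]

/-- If every point of `C` is far from `A` in some weighted Hamming distance, then `A` and `C`
cannot both be likely. -/
theorem prodWeight_mul_prodWeight_le {n : ℕ} {w : Fin n → α → ℝ} (hw : ∀ i a, 0 ≤ w i a)
    (hw1 : ∀ i, ∑ a, w i a = 1) (A C : Finset (Fin n → α)) {q : ℝ}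
    (h : ∀ x ∈ C, ∃ (v : Fin n → ℝ) (τ : ℝ), (∀ i, 0 ≤ v i) ∧ 0 < τ ∧
      (∀ y ∈ A, τ ≤ ∑ i, v i * (if x i = y i then 0 else 1)) ∧ q * ∑ i, v i ^ 2 ≤ τ ^ 2) :
    prodWeight w A * prodWeight w C ≤ Real.exp (-(q / 8)) := by
  rcases (prodWeight_nonneg hw A).eq_or_lt with hA | hA
  · rw [← hA, zero_mul]; exact Real.exp_nonneg _
  obtain ⟨s, hs, hle⟩ := talagrand_convex_distance n w hw hw1 A hA
  have h1 : prodWeight w C * Real.exp (q / 8) ≤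
      ∑ x, (∏ i, w i (x i)) * Real.exp ((∑ i, s x i ^ 2) / 8) := by
    rw [prodWeight, Finset.sum_mul]
    have hn : ∀ x : Fin n → α, 0 ≤ ∏ i, w i (x i) := fun x => Finset.prod_nonneg fun _ _ => hw _ _
    refine le_trans (Finset.sum_le_sum fun x hx => ?_) (Finset.sum_le_sum_of_subset_of_nonneg
      (Finset.subset_univ C) fun x _ _ => mul_nonneg (hn x) (Real.exp_nonneg _))
    refine mul_le_mul_of_nonneg_left (Real.exp_le_exp.2 ?_) (hn x)
    obtain ⟨v, τ, hv, hτ, hd, hq⟩ := h x hx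
    obtain ⟨y, hy, hys⟩ := hs x v hv
    have h2 : τ ≤ ∑ i, v i * s x i := (hd y hy).trans hys
    -- By Cauchy–Schwarz, separation by `τ` in the weighting `v` forces the dominating vector to
    -- have squared length at least `τ ^ 2 / ∑ v i ^ 2`.
    have h3 := Finset.sum_mul_sq_le_sq_mul_sq Finset.univ v (s x)
    have h4 : τ ^ 2 ≤ (∑ i, v i * s x i) ^ 2 := pow_le_pow_left₀ hτ.le h2 2
    have h5 : 0 < τ ^ 2 := by positivity
    have h6 : 0 < ∑ i, v i ^ 2 := by
      rcases (Finset.sum_nonneg fun i (_ : i ∈ Finset.univ) => sq_nonneg (v i)).eq_or_lt with h' | h'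
      · rw [← h'] at h3; linarith
      · exact h'
    have h7 : q ≤ ∑ i, s x i ^ 2 := by
      refine le_of_mul_le_mul_right ?_ h6
      linarith
    linarith
  rw [Real.exp_neg, ← one_div, le_div_iff₀ (Real.exp_pos _)]
  nlinarith [mul_le_mul_of_nonneg_right h1 hA.le]
end

/-! ### Deviation of pair counts over independent sites -/

/-- The weighted number of ordered pairs of occupied sites. -/
noncomputable def pairSum {n : ℕ} (g : Fin n → Fin n → ℝ) (x : Fin n → Bool) : ℝ :=
  ∑ i, (if x i then 1 else 0) * ∑ j, (if x j then 1 else 0) * g i j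

/-- The weighted number of occupied neighbours of a site. -/
noncomputable def siteDegree {n : ℕ} (g : Fin n → Fin n → ℝ) (x : Fin n → Bool) (i : Fin n) : ℝ :=
  ∑ j, (if x j then 1 else 0) * g i j

theorem siteDegree_nonneg {n : ℕ} {g : Fin n → Fin n → ℝ} (hg : ∀ i j, 0 ≤ g i j)
    (x : Fin n → Bool) (i : Fin n) : 0 ≤ siteDegree g x i :=
  Finset.sum_nonneg fun j _ => mul_nonneg (by split_ifs <;> norm_num) (hg i j)

/-- A pair present in `x` and missing in `y` has an endpoint where the two differ; by symmetry of
`g` both endpoints contribute equally, hence the factor 2. -/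
theorem pairSum_sub_le {n : ℕ} {g : Fin n → Fin n → ℝ} (hg : ∀ i j, 0 ≤ g i j)
    (hs : ∀ i j, g i j = g j i) (x y : Fin n → Bool) :
    pairSum g x - pairSum g y ≤
      ∑ i, 2 * ((if x i then 1 else 0) * siteDegree g x i) * (if x i = y i then 0 else 1) := by
  have e1 : ∑ i, 2 * ((if x i then (1 : ℝ) else 0) * siteDegree g x i) * (if x i = y i then 0 else 1)
      = (∑ i, ∑ j, (if x i then (1 : ℝ) else 0) * (if x j then 1 else 0) * g i j *
          (if x i = y i then 0 else 1)) +
        ∑ i, ∑ j, (if x i then (1 : ℝ) else 0) * (if x j then 1 else 0) * g i j *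
          (if x j = y j then 0 else 1) := by
    have e2 : ∑ i, ∑ j, (if x i then (1 : ℝ) else 0) * (if x j then 1 else 0) * g i j *
          (if x j = y j then 0 else 1) = ∑ i, ∑ j, (if x i then (1 : ℝ) else 0) *
          (if x j then 1 else 0) * g i j * (if x i = y i then 0 else 1) := by
      rw [Finset.sum_comm]
      refine Finset.sum_congr rfl fun i _ => Finset.sum_congr rfl fun j _ => ?_
      rw [hs j i]; ring
    rw [e2, ← Finset.sum_add_distrib]
    refine Finset.sum_congr rfl fun i _ => ?_
    rw [siteDegree, Finset.mul_sum, Finset.mul_sum, Finset.sum_mul, ← Finset.sum_add_distrib]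
    exact Finset.sum_congr rfl fun j _ => by ring
  rw [e1, pairSum, pairSum, ← Finset.sum_sub_distrib, ← Finset.sum_add_distrib]
  refine Finset.sum_le_sum fun i _ => ?_
  rw [Finset.mul_sum, Finset.mul_sum, ← Finset.sum_sub_distrib, ← Finset.sum_add_distrib]
  refine Finset.sum_le_sum fun j _ => ?_
  have := hg i j
  cases x i <;> cases x j <;> cases y i <;> cases y j <;> simp <;> linarith

/-- The weights `v i` are twice the degrees of the occupied sites of `x`. Bounding one factor of
each squared degree by `D` gives `∑ v i ^ 2 ≤ 4 * D * pairSum g x`, and `(G - a) ^ 2 / G` increases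
for `G ≥ a`, so `G = b` is the worst case. -/
theorem prodWeight_pairSum_le {n : ℕ} {w : Fin n → Bool → ℝ} (hw : ∀ i a, 0 ≤ w i a)
    (hw1 : ∀ i, ∑ a, w i a = 1) {g : Fin n → Fin n → ℝ} (hg : ∀ i j, 0 ≤ g i j)
    (hs : ∀ i j, g i j = g j i) {a b D : ℝ} (ha : 0 ≤ a) (hab : a < b) (hD : 0 < D)
    (A C : Finset (Fin n → Bool)) (hA : ∀ x ∈ A, pairSum g x ≤ 2 * a)
    (hC : ∀ x ∈ C, 2 * b ≤ pairSum g x ∧ ∀ i, x i = true → siteDegree g x i ≤ D) :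
    prodWeight w A * prodWeight w C ≤ Real.exp (-((b - a) ^ 2 / (16 * D * b))) := by
  have hb : 0 < b := by linarith
  have e : (b - a) ^ 2 / (16 * D * b) = ((b - a) ^ 2 / (2 * D * b)) / 8 := by
    field_simp; ring
  rw [e]
  refine prodWeight_mul_prodWeight_le hw hw1 A C fun x hx => ?_
  obtain ⟨hF, hdeg⟩ := hC x hx
  refine ⟨fun i => 2 * ((if x i then 1 else 0) * siteDegree g x i), pairSum g x - 2 * a,
    fun i => ?_, by linarith, fun y hy => ?_, ?_⟩
  · have := siteDegree_nonneg hg x i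
    positivity
  · linarith [pairSum_sub_le hg hs x y, hA y hy]
  · have h1 : ∑ i, (2 * ((if x i then (1 : ℝ) else 0) * siteDegree g x i)) ^ 2
        ≤ 4 * D * pairSum g x := by
      rw [pairSum, Finset.mul_sum]
      refine Finset.sum_le_sum fun i _ => ?_
      change _ ≤ 4 * D * (_ * siteDegree g x i)
      by_cases h : x i = true
      · have := siteDegree_nonneg hg x i
        have := hdeg i h
        simp only [h, if_true]
        nlinarith
      · simp [h]
    obtain ⟨G, hG⟩ : ∃ G, pairSum g x = 2 * G := ⟨pairSum g x / 2, by ring⟩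
    rw [hG] at h1 hF ⊢
    have hGb : b ≤ G := by linarith
    calc _ ≤ (b - a) ^ 2 / (2 * D * b) * (4 * D * (2 * G)) :=
          mul_le_mul_of_nonneg_left h1 (by positivity)
      _ = 4 * ((b - a) ^ 2 * G / b) := by field_simp
      _ ≤ 4 * (G - a) ^ 2 := by
          refine mul_le_mul_of_nonneg_left ?_ (by norm_num)
          rw [div_le_iff₀ hb]
          have h2 : 0 ≤ G * b - a ^ 2 := by nlinarith
          nlinarith [mul_nonneg (sub_nonneg.2 hGb) h2]
      _ = _ := by ring

section
variable {Ω : Type*} [MeasurableSpace Ω] {P : Measure Ω} [IsProbabilityMeasure P]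

theorem ProbabilityTheory.iIndepFun.measureReal_mem_eq_prodWeight {n : ℕ} {Y : Fin n → Ω → Bool}
    (hY : iIndepFun Y P) (hm : ∀ i, Measurable (Y i)) (A : Finset (Fin n → Bool)) :
    P.real {ω | (fun i => Y i ω) ∈ A} = prodWeight (fun i c => P.real (Y i ⁻¹' {c})) A := by
  have h1 : ∀ x : Fin n → Bool, (fun ω i => Y i ω) ⁻¹' {x} = ⋂ i ∈ Finset.univ, Y i ⁻¹' {x i} := by
    intro x; ext ω; simp [funext_iff]
  have h2 : {ω | (fun i => Y i ω) ∈ A} = ⋃ x ∈ A, (fun ω i => Y i ω) ⁻¹' {x} := by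
    ext ω; simp
  rw [h2, measureReal_biUnion_finset, prodWeight]
  · refine Finset.sum_congr rfl fun x _ => ?_
    rw [h1, measureReal_def, hY.measure_inter_preimage_eq_mul Finset.univ fun i _ => by simp,
      ENNReal.toReal_prod]
    rfl
  · intro x _ y _ hxy
    exact Disjoint.preimage _ (Set.disjoint_singleton.2 hxy)
  · intro x _
    exact measurable_pi_lambda _ hm (measurableSet_singleton x)

theorem ProbabilityTheory.iIndepFun.pairSum_le {n : ℕ} {Y : Fin n → Ω → Bool}
    (hY : iIndepFun Y P) (hm : ∀ i, Measurable (Y i)) {g : Fin n → Fin n → ℝ}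
    (hg : ∀ i j, 0 ≤ g i j) (hs : ∀ i j, g i j = g j i) {a b D : ℝ} (ha : 0 ≤ a) (hab : a < b)
    (hD : 0 < D) :
    P.real {ω | pairSum g (fun i => Y i ω) ≤ 2 * a} *
      P.real {ω | 2 * b ≤ pairSum g (fun i => Y i ω) ∧
        ∀ i, Y i ω = true → siteDegree g (fun i => Y i ω) i ≤ D} ≤
      Real.exp (-((b - a) ^ 2 / (16 * D * b))) := by
  classical
  have h1 := hY.measureReal_mem_eq_prodWeight hm (Finset.univ.filter fun x => pairSum g x ≤ 2 * a)
  have h2 := hY.measureReal_mem_eq_prodWeight hm (Finset.univ.filter fun x =>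
    2 * b ≤ pairSum g x ∧ ∀ i, x i = true → siteDegree g x i ≤ D)
  simp only [Finset.mem_filter, Finset.mem_univ, true_and] at h1 h2
  rw [h1, h2]
  refine prodWeight_pairSum_le (fun _ _ => measureReal_nonneg) (fun i => ?_) hg hs ha hab hD _ _
    (fun x hx => (Finset.mem_filter.1 hx).2) (fun x hx => (Finset.mem_filter.1 hx).2)
  rw [← measureReal_biUnion_finset]
  · convert probReal_univ (μ := P)
    ext ω; simp
  · intro x _ y _ hxy
    exact Disjoint.preimage _ (Set.disjoint_singleton.2 hxy)
  · intro x _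
    exact hm i (measurableSet_singleton x)

/-- `A` and `C` lie in the lower limits of `S` and `T`, which are increasing unions of tail
intersections. Continuity from below holds for arbitrary sets, so measurability plays no role. -/
theorem measureReal_mul_le_of_eventually {A C : Set Ω} {S T : ℕ → Set Ω} {q : ℝ}
    (hA : ∀ ω ∈ A, ∀ᶠ n in atTop, ω ∈ S n) (hC : ∀ ω ∈ C, ∀ᶠ n in atTop, ω ∈ T n)
    (h : ∀ n, P.real (S n) * P.real (T n) ≤ q) : P.real A * P.real C ≤ q := by
  have key : ∀ (B : Set Ω) (U : ℕ → Set Ω), (∀ ω ∈ B, ∀ᶠ n in atTop, ω ∈ U n) →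
      Tendsto (fun N => P.real (⋂ n ≥ N, U n)) atTop (𝓝 (P.real (⋃ N, ⋂ n ≥ N, U n))) ∧
      P.real B ≤ P.real (⋃ N, ⋂ n ≥ N, U n) := by
    intro B U hU
    refine ⟨?_, measureReal_mono fun ω hω => ?_⟩
    · refine (ENNReal.tendsto_toReal (measure_ne_top _ _)).comp
        (tendsto_measure_iUnion_atTop fun M N hMN => ?_)
      exact Set.biInter_subset_biInter_left fun n (hn : N ≤ n) => hMN.trans hn
    · obtain ⟨N, hN⟩ := eventually_atTop.1 (hU ω hω)
      exact Set.mem_iUnion.2 ⟨N, Set.mem_iInter₂.2 hN⟩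
  obtain ⟨hA1, hA2⟩ := key A S hA
  obtain ⟨hC1, hC2⟩ := key C T hC
  refine (mul_le_mul hA2 hC2 measureReal_nonneg measureReal_nonneg).trans ?_
  refine le_of_tendsto (hA1.mul hC1) (Eventually.of_forall fun N => ?_)
  refine le_trans (mul_le_mul ?_ ?_ measureReal_nonneg measureReal_nonneg) (h N) <;>
  exact measureReal_mono (Set.biInter_subset_of_mem (le_refl N))
end

/-! ### Discretising the Poisson process by Voronoi cells -/

section
variable {E : Type*} [NormedAddCommGroup E] [MeasurableSpace E] [BorelSpace E]
  [TopologicalSpace.SeparableSpace E]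

/-- The cell of `x` in the Voronoi partition generated by the first `n + 1` points of a fixed dense
sequence. -/
noncomputable def voronoiIndex (n : ℕ) (x : E) : Fin (n + 1) :=
  ⟨SimpleFunc.nearestPtInd (TopologicalSpace.denseSeq E) n x,
    Nat.lt_succ_of_le (SimpleFunc.nearestPtInd_le _ _ _)⟩

theorem measurable_voronoiIndex (n : ℕ) : Measurable (voronoiIndex n : E → Fin (n + 1)) := by
  refine measurable_to_countable' fun i => ?_
  convert SimpleFunc.measurableSet_fiber
    (SimpleFunc.nearestPtInd (TopologicalSpace.denseSeq E) n) (i : ℕ) using 1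
  ext x
  simp [voronoiIndex, Fin.ext_iff]

theorem tendsto_denseSeq_voronoiIndex (x : E) :
    Tendsto (fun n => TopologicalSpace.denseSeq E (voronoiIndex n x)) atTop (𝓝 x) :=
  SimpleFunc.tendsto_nearestPt (e := TopologicalSpace.denseSeq E)
    (by rw [(TopologicalSpace.denseRange_denseSeq E).closure_range]; trivial)

open Classical in
/-- The indicator of the cells hit by the configuration `S`. -/
noncomputable def occupied (n : ℕ) (S : Set E) (i : Fin (n + 1)) : Bool :=
  decide ((S ∩ voronoiIndex n ⁻¹' {i}).encard ≠ 0)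

theorem occupied_eq_true {n : ℕ} {S : Set E} {i : Fin (n + 1)} :
    occupied n S i = true ↔ ∃ x ∈ S, voronoiIndex n x = i := by
  simp [occupied, Set.nonempty_iff_ne_empty.symm, Set.Nonempty]

open Classical in
/-- The adjacency matrix of the Gilbert graph of the first `n + 1` points of the dense sequence. -/
noncomputable def cellAdj (E : Type*) [NormedAddCommGroup E] [TopologicalSpace.SeparableSpace E]
    (n : ℕ) (ρ : ℝ) (i j : Fin (n + 1)) : ℝ :=
  if i ≠ j ∧ ‖TopologicalSpace.denseSeq E i - TopologicalSpace.denseSeq E j‖ ≤ ρ then 1 else 0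

theorem sum_occupied_mul {n : ℕ} {S : Finset E} (hS : Set.InjOn (voronoiIndex n) (S : Set E))
    (f : Fin (n + 1) → ℝ) :
    ∑ i, (if occupied n (S : Set E) i then 1 else 0) * f i = ∑ x ∈ S, f (voronoiIndex n x) := by
  classical
  rw [← Finset.sum_image (f := f) hS]
  simp only [ite_mul, one_mul, zero_mul]
  rw [← Finset.sum_filter]
  congr 1
  ext i
  simp [occupied_eq_true]

/-- The partition separates the points of `S` and its centres reproduce the Gilbert graph. -/
def Resolves (n : ℕ) (ρ r : ℝ) (S : Set E) : Prop :=
  Set.InjOn (voronoiIndex n) S ∧ ∀ x ∈ S, ∀ y ∈ S,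
    (‖TopologicalSpace.denseSeq E (voronoiIndex n x) -
      TopologicalSpace.denseSeq E (voronoiIndex n y)‖ ≤ ρ ↔ ‖x - y‖ ≤ r)

/-- The condition `‖x - y‖ ≤ r` is not stable under moving points to cell centres. The slack `1 / (k
+ 1)` makes it strict, and for large `k` stays below the finitely many distances exceeding `r`. So
`k` is fixed before the mesh is refined. -/
theorem eventually_resolves {S : Set E} (hS : S.Finite) (r : ℝ) :
    ∀ᶠ k : ℕ in atTop, ∀ᶠ n in atTop, Resolves n (r + 1 / ((k : ℝ) + 1)) r S := by
  have h1 : ∀ᶠ k : ℕ in atTop, ∀ x ∈ S, ∀ y ∈ S, r < ‖x - y‖ → r + 1 / ((k : ℝ) + 1) < ‖x - y‖ := by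
    refine (eventually_all_finite hS).2 fun x _ => (eventually_all_finite hS).2 fun y _ => ?_
    by_cases h : r < ‖x - y‖
    · have h2 : Tendsto (fun k : ℕ => r + 1 / ((k : ℝ) + 1)) atTop (𝓝 (r + 0)) :=
        tendsto_const_nhds.add tendsto_one_div_add_atTop_nhds_zero_nat
      rw [add_zero] at h2
      filter_upwards [h2.eventually_lt_const h] with k hk _ using hk
    · exact Eventually.of_forall fun k hk => absurd hk h
  filter_upwards [h1] with k hk
  have hpos : 0 < 1 / ((k : ℝ) + 1) := by positivity
  have h2 : ∀ᶠ n in atTop, ∀ x ∈ S, ∀ y ∈ S, x ≠ y → voronoiIndex n x ≠ voronoiIndex n y := by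
    refine (eventually_all_finite hS).2 fun x _ => (eventually_all_finite hS).2 fun y _ => ?_
    by_cases h : x = y
    · exact Eventually.of_forall fun n hn => absurd h hn
    · have h3 := ((tendsto_denseSeq_voronoiIndex x).sub (tendsto_denseSeq_voronoiIndex y)).norm
      filter_upwards [h3.eventually_const_lt (norm_pos_iff.2 (sub_ne_zero.2 h))] with n hn _ hc
      rw [hc, sub_self, norm_zero] at hn
      exact lt_irrefl _ hn
  have h3 : ∀ᶠ n in atTop, ∀ x ∈ S, ∀ y ∈ S,
      (‖TopologicalSpace.denseSeq E (voronoiIndex n x) -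
        TopologicalSpace.denseSeq E (voronoiIndex n y)‖ ≤ r + 1 / ((k : ℝ) + 1) ↔ ‖x - y‖ ≤ r) := by
    refine (eventually_all_finite hS).2 fun x hx => (eventually_all_finite hS).2 fun y hy => ?_
    have h4 := ((tendsto_denseSeq_voronoiIndex x).sub (tendsto_denseSeq_voronoiIndex y)).norm
    rcases le_or_gt ‖x - y‖ r with h | h
    · filter_upwards [h4.eventually_lt_const (show ‖x - y‖ < r + 1 / ((k : ℝ) + 1) by linarith)]
        with n hn
      exact ⟨fun _ => h, fun _ => hn.le⟩
    · filter_upwards [h4.eventually_const_lt (hk x hx y hy h)] with n hn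
      exact ⟨fun h' => absurd hn h'.not_gt, fun h' => absurd h h'.not_gt⟩
  filter_upwards [h2, h3] with n hn2 hn3
  exact ⟨fun x hx y hy hxy => by_contra fun h => hn2 x hx y hy h hxy, hn3⟩

open Classical in
theorem siteDegree_occupied {n : ℕ} {ρ r : ℝ} {S : Finset E} (h : Resolves n ρ r (S : Set E))
    {x : E} (hx : x ∈ S) :
    siteDegree (cellAdj E n ρ) (occupied n (S : Set E)) (voronoiIndex n x) =
      ((S.filter fun y => x ≠ y ∧ ‖x - y‖ ≤ r).card : ℝ) := by
  rw [siteDegree, sum_occupied_mul h.1, Finset.card_filter]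
  push_cast
  refine Finset.sum_congr rfl fun y hy => ?_
  simp only [cellAdj]
  have h1 : voronoiIndex n x ≠ voronoiIndex n y ↔ x ≠ y := (h.1.eq_iff hx hy).not
  have h2 := h.2 x hx y hy
  simp only [h1, h2]

theorem pairSum_occupied {n : ℕ} {ρ r : ℝ} {S : Set E} (hS : S.Finite) (h : Resolves n ρ r S) :
    pairSum (cellAdj E n ρ) (occupied n S) = 2 * (gilbertEdgeCount S r : ℝ) := by
  classical
  lift S to Finset E using hS
  have e := two_mul_gilbertEdgeCount (S : Set E) S.finite_toSet r
  have e1 : {p : E × E | p.1 ∈ (S : Set E) ∧ p.2 ∈ (S : Set E) ∧ p.1 ≠ p.2 ∧ ‖p.1 - p.2‖ ≤ r}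
      = ((S ×ˢ S).filter fun p : E × E => p.1 ≠ p.2 ∧ ‖p.1 - p.2‖ ≤ r : Finset (E × E)) := by
    ext p; simp [and_assoc]
  rw [e1, Set.ncard_coe_finset] at e
  have e2 : (2 * (gilbertEdgeCount (S : Set E) r : ℝ)) = ((2 * gilbertEdgeCount (S : Set E) r : ℕ) : ℝ) := by
    push_cast; rfl
  rw [e2, e, Finset.card_filter, Finset.sum_product]
  change ∑ i, _ * siteDegree _ _ i = _
  rw [sum_occupied_mul h.1]
  push_cast
  refine Finset.sum_congr rfl fun x hx => ?_
  rw [siteDegree_occupied h hx, Finset.card_filter]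
  push_cast
  rfl

theorem siteDegree_occupied_le {n : ℕ} {ρ r : ℝ} {S : Set E} (hS : S.Finite)
    (h : Resolves n ρ r S) {D : ℕ} (hD : ∀ x ∈ S, (S ∩ Metric.closedBall x r).encard ≤ D)
    (i : Fin (n + 1)) (hi : occupied n S i = true) :
    siteDegree (cellAdj E n ρ) (occupied n S) i ≤ D := by
  classical
  obtain ⟨x, hx, rfl⟩ := occupied_eq_true.1 hi
  have h1 := hD x hx
  lift S to Finset E using hS
  rw [siteDegree_occupied h hx]
  have h2 : ((S.filter fun y => x ≠ y ∧ ‖x - y‖ ≤ r : Finset E) : Set E) ⊆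
      (S : Set E) ∩ Metric.closedBall x r := by
    intro y hy
    simp only [Finset.coe_filter, Set.mem_ofPred_eq] at hy
    exact ⟨hy.1, by rw [Metric.mem_closedBall, dist_comm, dist_eq_norm]; exact hy.2.2⟩
  have h3 := (Set.encard_le_encard h2).trans h1
  rw [Set.encard_coe_eq_coe_finsetCard] at h3
  exact_mod_cast h3

theorem IsPoissonPointProcess.gilbertEdgeCount_mul_le {Ω : Type*} [MeasurableSpace Ω]
    {P : Measure Ω} [IsProbabilityMeasure P] {η : Ω → Set E} {μ : Measure E}
    (hη : IsPoissonPointProcess P η μ) (r : ℝ) {a b : ℝ} {D : ℕ} (ha : 0 ≤ a) (hab : a < b)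
    (hD : 0 < D) :
    P.real {ω | (η ω).Finite ∧ (gilbertEdgeCount (η ω) r : ℝ) ≤ a} *
      P.real {ω | (η ω).Finite ∧ b ≤ (gilbertEdgeCount (η ω) r : ℝ) ∧
        ∀ x ∈ η ω, (η ω ∩ Metric.closedBall x r).encard ≤ D} ≤
      Real.exp (-((b - a) ^ 2 / (16 * D * b))) := by
  have hind : ∀ n, iIndepFun (fun i ω => occupied n (η ω) i) P := by
    intro n
    have h1 := hη.indep_count (n + 1) (fun i => voronoiIndex n ⁻¹' {i})
      (fun i => measurable_voronoiIndex n (measurableSet_singleton i))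
      (fun i j hij => Disjoint.preimage _ (Set.disjoint_singleton.2 hij))
    classical
    exact h1.comp (fun _ c => decide (c ≠ 0)) (fun _ => measurable_from_top)
  have hmeas : ∀ n i, Measurable fun ω => occupied n (η ω) i := by
    intro n i
    classical
    exact (measurable_from_top (f := fun c : ℕ∞ => decide (c ≠ 0))).comp
      (hη.measurable_count _ (measurable_voronoiIndex n (measurableSet_singleton i)))
  have hstep : ∀ (n : ℕ) (ρ : ℝ), _ := fun n ρ =>
    (hind n).pairSum_le (hmeas n) (g := cellAdj E n ρ)
      (fun i j => by unfold cellAdj; split_ifs <;> norm_num)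
      (fun i j => by unfold cellAdj; simp only [ne_comm, norm_sub_rev]) ha hab
      (show (0 : ℝ) < D by exact_mod_cast hD)
  -- Two nested limits: the outer one in the slack index `k`, the inner one in the mesh index `n`.
  refine measureReal_mul_le_of_eventually
    (S := fun k => {ω | ∀ᶠ n in atTop,
      ω ∈ {ω | pairSum (cellAdj E n (r + 1 / ((k : ℝ) + 1))) (fun i => occupied n (η ω) i) ≤ 2 * a}})
    (T := fun k => {ω | ∀ᶠ n in atTop,
      ω ∈ {ω | 2 * b ≤ pairSum (cellAdj E n (r + 1 / ((k : ℝ) + 1))) (fun i => occupied n (η ω) i) ∧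
        ∀ i, occupied n (η ω) i = true →
          siteDegree (cellAdj E n (r + 1 / ((k : ℝ) + 1))) (fun i => occupied n (η ω) i) i ≤ D}})
    ?_ ?_ fun k => measureReal_mul_le_of_eventually (fun ω hω => hω) (fun ω hω => hω)
      fun n => hstep n _
  · rintro ω ⟨hfin, hle⟩
    filter_upwards [eventually_resolves hfin r] with k hk
    filter_upwards [hk] with n hn
    change pairSum _ (occupied n (η ω)) ≤ _
    rw [pairSum_occupied hfin hn]
    linarith
  · rintro ω ⟨hfin, hle, hdeg⟩
    filter_upwards [eventually_resolves hfin r] with k hk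
    filter_upwards [hk] with n hn
    refine ⟨?_, fun i hi => siteDegree_occupied_le hfin hn hdeg i hi⟩
    change _ ≤ pairSum _ (occupied n (η ω))
    rw [pairSum_occupied hfin hn]
    linarith
end

/-! ### Poisson tails and crowded cells -/

open scoped ENNReal NNReal

/-- Since `j! * k! ≤ (j + k)!`, the mass at `j + k` is at most `r ^ k / k!` times the mass at `j`;
these masses sum to one. -/
theorem ProbabilityTheory.poissonMeasure_Ici_le (r : ℝ≥0) (k : ℕ) :
    poissonMeasure r (Set.Ici k) ≤ (r : ℝ≥0∞) ^ k / (k.factorial : ℝ≥0∞) := by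
  have e : Set.Ici k = ⋃ j : ℕ, {j + k} := by
    ext n
    simp only [Set.mem_Ici, Set.mem_iUnion, Set.mem_singleton_iff]
    exact ⟨fun h => ⟨n - k, by omega⟩, by rintro ⟨j, rfl⟩; omega⟩
  have hq : (r : ℝ≥0∞) ^ k / (k.factorial : ℝ≥0∞) = ENNReal.ofReal ((r : ℝ) ^ k / k.factorial) := by
    rw [ENNReal.ofReal_div_of_pos (by positivity), ENNReal.ofReal_pow (by positivity),
      ENNReal.ofReal_coe_nnreal, ENNReal.ofReal_natCast]
  rw [e]
  calc _ ≤ ∑' j, poissonMeasure r {j + k} := measure_iUnion_le _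
    _ ≤ ∑' j, poissonMeasure r {j} * ENNReal.ofReal ((r : ℝ) ^ k / k.factorial) := by
        refine ENNReal.tsum_le_tsum fun j => ?_
        rw [poissonMeasure_singleton, poissonMeasure_singleton,
          ← ENNReal.ofReal_mul (by positivity)]
        refine ENNReal.ofReal_le_ofReal ?_
        have h1 : ((j.factorial * k.factorial : ℕ) : ℝ) ≤ ((j + k).factorial : ℝ) := by
          exact_mod_cast Nat.le_of_dvd (Nat.factorial_pos _)
            (Nat.factorial_mul_factorial_dvd_factorial_add j k)
        push_cast at h1
        calc _ ≤ Real.exp (-r) * (r : ℝ) ^ (j + k) / (j.factorial * k.factorial) := by gcongr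
          _ = _ := by rw [pow_add]; field_simp
    _ = _ := by
        rw [ENNReal.tsum_mul_right]
        have h2 : ∑' j, poissonMeasure r {j} = 1 := by
          rw [← measure_iUnion, Set.iUnion_of_singleton, measure_univ]
          · intro i j hij
            exact Set.disjoint_singleton.2 hij
          · exact fun _ => measurableSet_singleton _
        rw [h2, one_mul, hq]

namespace IsPoissonPointProcess
variable {Ω X : Type*} [MeasurableSpace Ω] [MeasurableSpace X] {P : Measure Ω} {η : Ω → Set X}
  {μ : Measure X}

theorem measure_le_encard (hη : IsPoissonPointProcess P η μ) {B : Set X} (hB : MeasurableSet B)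
    (hfin : μ B ≠ ⊤) (k : ℕ) :
    P {ω | (k : ℕ∞) ≤ (η ω ∩ B).encard} ≤ μ B ^ k / (k.factorial : ℝ≥0∞) := by
  have h1 := hη.law_count B hB hfin
  have hm : MeasurableSet {c : ℕ∞ | (k : ℕ∞) ≤ c} := MeasurableSet.of_discrete
  have h2 : P {ω | (k : ℕ∞) ≤ (η ω ∩ B).encard} =
      (P.map fun ω => (η ω ∩ B).encard) {c : ℕ∞ | (k : ℕ∞) ≤ c} :=
    (Measure.map_apply (hη.measurable_count B hB) hm).symm
  rw [h2, h1.map_eq, Measure.map_apply measurable_from_top hm]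
  have h3 : (Nat.cast : ℕ → ℕ∞) ⁻¹' {c : ℕ∞ | (k : ℕ∞) ≤ c} = Set.Ici k := by
    ext n; simp
  rw [h3]
  refine (poissonMeasure_Ici_le _ _).trans_eq ?_
  rw [ENNReal.coe_toNNReal hfin]

theorem ae_finite (hη : IsPoissonPointProcess P η μ) [IsFiniteMeasure μ] :
    ∀ᵐ ω ∂P, (η ω).Finite := by
  have h1 := hη.law_count Set.univ MeasurableSet.univ (measure_ne_top _ _)
  have hm : MeasurableSet ({⊤} : Set ℕ∞) := measurableSet_singleton _
  have h2 : P {ω | (η ω).encard = ⊤} = 0 := by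
    have h3 : P {ω | (η ω).encard = ⊤} = (P.map fun ω => (η ω ∩ Set.univ).encard) {⊤} := by
      rw [Measure.map_apply (hη.measurable_count _ MeasurableSet.univ) hm]
      simp only [Set.inter_univ]
      rfl
    rw [h3, h1.map_eq, Measure.map_apply measurable_from_top hm]
    convert measure_empty (μ := poissonMeasure _)
    ext n; simp
  rw [ae_iff]
  convert h2 using 2
  ext ω
  exact Set.encard_eq_top_iff.symm

/-- The tail is taken at `k + 1`, so that one factor `μ (c ⁻¹' {z})` survives in the union bound and
sums to the total mass. This is the source of the linear factor `t`. -/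
theorem measure_exists_cell_le (hη : IsPoissonPointProcess P η μ) [IsFiniteMeasure μ]
    {ι : Type*} [Countable ι] [MeasurableSpace ι] [MeasurableSingletonClass ι] {c : X → ι}
    (hc : Measurable c) {L : ℝ≥0∞} (hL : ∀ z, μ (c ⁻¹' {z}) ≤ L) (k : ℕ) :
    P {ω | ∃ z, ((k + 1 : ℕ) : ℕ∞) ≤ (η ω ∩ c ⁻¹' {z}).encard} ≤
      μ Set.univ * (L ^ k / (k.factorial : ℝ≥0∞)) := by
  have hm : ∀ z, MeasurableSet (c ⁻¹' {z}) := fun z => hc (measurableSet_singleton z)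
  have e : {ω | ∃ z, ((k + 1 : ℕ) : ℕ∞) ≤ (η ω ∩ c ⁻¹' {z}).encard} =
      ⋃ z, {ω | ((k + 1 : ℕ) : ℕ∞) ≤ (η ω ∩ c ⁻¹' {z}).encard} := by ext; simp
  rw [e]
  calc _ ≤ ∑' z, P {ω | ((k + 1 : ℕ) : ℕ∞) ≤ (η ω ∩ c ⁻¹' {z}).encard} := measure_iUnion_le _
    _ ≤ ∑' z, μ (c ⁻¹' {z}) * (L ^ k / (k.factorial : ℝ≥0∞)) := by
        refine ENNReal.tsum_le_tsum fun z =>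
          (hη.measure_le_encard (hm z) (measure_ne_top _ _) (k + 1)).trans ?_
        rw [pow_succ', mul_div_assoc]
        gcongr
        · exact hL z
        · exact Nat.le_succ k
    _ = _ := by
        rw [ENNReal.tsum_mul_right, ← measure_iUnion _ hm]
        · congr 2
          ext x; simp
        · intro i j hij
          exact Disjoint.preimage _ (Set.disjoint_singleton.2 hij)

end IsPoissonPointProcess

/-! ### Cubes of side `r` control the degrees -/

section
variable {d : ℕ}

/-- The index of the cube of side `r` containing `x`. -/
noncomputable def cubeIndex (r : ℝ) (x : EuclideanSpace ℝ (Fin d)) (i : Fin d) : ℤ := ⌊x i / r⌋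

theorem measurable_cubeIndex (r : ℝ) :
    Measurable (cubeIndex r : EuclideanSpace ℝ (Fin d) → Fin d → ℤ) := by
  refine measurable_pi_lambda _ fun i => Int.measurable_floor.comp ?_
  have : Continuous fun x : EuclideanSpace ℝ (Fin d) => x i / r := by fun_prop
  exact this.measurable

theorem volume_cubeIndex_preimage {r : ℝ} (hr : 0 < r) (z : Fin d → ℤ) :
    volume (cubeIndex r ⁻¹' {z} : Set (EuclideanSpace ℝ (Fin d))) = ENNReal.ofReal (r ^ d) := by
  have e : (cubeIndex r ⁻¹' {z} : Set (EuclideanSpace ℝ (Fin d))) =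
      WithLp.ofLp ⁻¹' Set.univ.pi fun i => Set.Ico ((z i : ℝ) * r) ((z i : ℝ) * r + r) := by
    ext x
    simp only [Set.mem_preimage, Set.mem_singleton_iff, funext_iff, cubeIndex, Int.floor_eq_iff,
      le_div_iff₀ hr, div_lt_iff₀ hr, Set.mem_pi, Set.mem_univ, true_implies, Set.mem_Ico, add_mul,
      one_mul]
  rw [e, (PiLp.volume_preserving_ofLp (Fin d)).measure_preimage
    (MeasurableSet.univ_pi fun _ => measurableSet_Ico).nullMeasurableSet, Real.volume_pi_Ico]
  simp [ENNReal.ofReal_pow hr.le]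

theorem abs_cubeIndex_sub_le {r : ℝ} (hr : 0 < r) {x y : EuclideanSpace ℝ (Fin d)}
    (h : dist y x ≤ r) (i : Fin d) : |cubeIndex r y i - cubeIndex r x i| ≤ 1 := by
  have h1 : |y i - x i| ≤ r := by
    have := PiLp.norm_apply_le (y - x) i
    rw [← dist_eq_norm] at this
    exact this.trans h
  have h2 : |y i / r - x i / r| ≤ 1 := by
    rw [← sub_div, abs_div, abs_of_pos hr]
    exact (div_le_one hr).2 h1
  obtain ⟨h3, h4⟩ := abs_le.1 h2
  simp only [cubeIndex]
  rw [abs_le]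
  constructor
  · have : ⌊x i / r⌋ ≤ ⌊y i / r⌋ + 1 := by
      rw [← Int.floor_add_one]; exact Int.floor_le_floor (by linarith)
    omega
  · have : ⌊y i / r⌋ ≤ ⌊x i / r⌋ + 1 := by
      rw [← Int.floor_add_one]; exact Int.floor_le_floor (by linarith)
    omega

theorem encard_biUnion_finset_le {α ι : Type*} (s : Finset ι) (f : ι → Set α) {k : ℕ}
    (h : ∀ i ∈ s, (f i).encard ≤ k) : (⋃ i ∈ s, f i).encard ≤ (s.card * k : ℕ) := by
  classical
  induction s using Finset.induction_on with
  | empty => simp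
  | insert a s ha ih =>
    rw [Finset.set_biUnion_insert, Finset.card_insert_of_notMem ha]
    refine (Set.encard_union_le _ _).trans ?_
    have h1 := add_le_add (h a (Finset.mem_insert_self a s))
      (ih fun i hi => h i (Finset.mem_insert_of_mem hi))
    refine h1.trans_eq ?_
    rw [add_mul, one_mul, add_comm]
    push_cast
    rfl

/-- A ball of radius `r` meets only the cube of its centre and the adjacent ones, `3 ^ d` in all. -/
theorem encard_inter_closedBall_le {r : ℝ} (hr : 0 < r) {S : Set (EuclideanSpace ℝ (Fin d))} {k : ℕ}
    (h : ∀ z, (S ∩ cubeIndex r ⁻¹' {z}).encard ≤ k) (x : EuclideanSpace ℝ (Fin d)) :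
    (S ∩ Metric.closedBall x r).encard ≤ (3 ^ d * k : ℕ) := by
  set s := Fintype.piFinset fun i : Fin d => Finset.Icc (cubeIndex r x i - 1) (cubeIndex r x i + 1)
  have hs : s.card = 3 ^ d := by
    rw [Fintype.card_piFinset]
    have : ∀ a : ℤ, (a + 1 + 1 - (a - 1)).toNat = 3 := fun a => by
      rw [show a + 1 + 1 - (a - 1) = 3 by ring]; rfl
    simp [this]
  rw [← hs]
  refine (Set.encard_le_encard ?_).trans (encard_biUnion_finset_le s _ fun z _ => h z)
  rintro y ⟨hy, hyx⟩
  refine Set.mem_iUnion₂.2 ⟨cubeIndex r y, ?_, hy, rfl⟩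
  rw [Fintype.mem_piFinset]
  intro i
  have := abs_le.1 (abs_cubeIndex_sub_le hr (Metric.mem_closedBall.1 hyx) i)
  rw [Finset.mem_Icc]
  omega
end

/-! ### Concentration around the median -/

/-- Factorials beat exponentials: `x < B * (k + 1)` gives `exp (x / 16) ≤ M ^ (k + 1)`, while `(L *
M) ^ k / k!` tends to zero. The bounds `3`, `2` and `16 ≤ c` are those required by
`exists_concentration_of_cube_le`. -/
theorem exists_pow_div_factorial_le_exp (B L : ℝ) (hB : 0 < B) :
    ∃ c : ℝ, 16 ≤ c ∧ ∀ x, c ≤ x → 1 ≤ ⌊x / B⌋₊ ∧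
      3 * (L ^ ⌊x / B⌋₊ / (⌊x / B⌋₊.factorial : ℝ)) ≤ 2 * Real.exp (-(x / 16)) := by
  set M := Real.exp (B / 16) with hM
  have hMpos : 0 < M := Real.exp_pos _
  obtain ⟨k₀, hk₀⟩ := eventually_atTop.1 ((FloorSemiring.tendsto_pow_div_factorial_atTop
    (L * M)).eventually_lt_const (show 0 < 1 / (2 * M) by positivity))
  refine ⟨16 + B * (k₀ + 1), by nlinarith [mul_nonneg hB.le (Nat.cast_nonneg (α := ℝ) k₀)],
    fun x hx => ?_⟩
  set k := ⌊x / B⌋₊ with hk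
  have h1 : ((k₀ + 1 : ℕ) : ℝ) ≤ x / B := by
    rw [le_div_iff₀ hB]; push_cast; linarith
  have h2 : k₀ + 1 ≤ k := Nat.le_floor h1
  have h3 : x < B * (k + 1) := by
    have := Nat.lt_floor_add_one (x / B)
    rw [div_lt_iff₀ hB] at this
    linarith
  have h4 : Real.exp (x / 16) ≤ M * M ^ k := by
    rw [hM, ← Real.exp_nat_mul, ← Real.exp_add]
    exact Real.exp_le_exp.2 (by linarith)
  have h5 := hk₀ k (by omega)
  rw [mul_pow, lt_div_iff₀ (by positivity)] at h5
  refine ⟨by omega, ?_⟩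
  rw [Real.exp_neg, ← div_eq_mul_inv, le_div_iff₀ (Real.exp_pos _)]
  rcases le_or_gt (L ^ k / (k.factorial : ℝ)) 0 with h | h
  · nlinarith [Real.exp_pos (x / 16)]
  · calc _ ≤ 3 * (L ^ k / (k.factorial : ℝ)) * (M * M ^ k) := by gcongr
      _ = 3 / 2 * (L ^ k * M ^ k / k.factorial * (2 * M)) := by ring
      _ ≤ 2 := by linarith

theorem IsMedian.nonneg {Ω : Type*} [MeasurableSpace Ω] {P : Measure Ω} {X : Ω → ℝ} {m : ℝ}
    (h : IsMedian P X m) (hX : ∀ ω, 0 ≤ X ω) : 0 ≤ m := by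
  by_contra! hm
  have h1 := h.1
  have : {ω | X ω ≤ m} = ∅ := by
    ext ω
    simp only [Set.mem_ofPred_eq, Set.mem_empty_iff_false, iff_false, not_le]
    exact hm.trans_le (hX ω)
  rw [this, measureReal_empty] at h1
  norm_num at h1

theorem gilbertEdgeCount_le_ncard_sq {E : Type*} [NormedAddCommGroup E] {S : Set E} (hS : S.Finite)
    (r : ℝ) : gilbertEdgeCount S r ≤ S.ncard ^ 2 := by
  have h1 := two_mul_gilbertEdgeCount S hS r
  have h2 : {p : E × E | p.1 ∈ S ∧ p.2 ∈ S ∧ p.1 ≠ p.2 ∧ ‖p.1 - p.2‖ ≤ r}.ncard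
      ≤ (S ×ˢ S).ncard :=
    Set.ncard_le_ncard (fun p hp => ⟨hp.1, hp.2.1⟩) (hS.prod hS)
  rw [Set.ncard_prod, ← sq] at h2
  omega

theorem div_sqrt_le_sqrt {u m : ℝ} (hu : 0 < u) (hm : 0 ≤ m) : u / √(u + m) ≤ √u := by
  calc u / √(u + m) ≤ u / √u := by gcongr; linarith
    _ = √u := Real.div_sqrt

theorem pos_of_pos_div_sqrt {u m : ℝ} (h : 0 < u / √(u + m)) : 0 < u := by
  by_contra! hu
  exact absurd (div_nonpos_of_nonpos_of_nonneg hu (Real.sqrt_nonneg _)) (not_le.2 h)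

namespace IsPoissonPointProcess

theorem measureReal_le_finite {Ω X : Type*} [MeasurableSpace Ω] [MeasurableSpace X] {P : Measure Ω}
    [IsFiniteMeasure P] {η : Ω → Set X} {μ : Measure X} [IsFiniteMeasure μ]
    (hη : IsPoissonPointProcess P η μ) (A : Set Ω) :
    P.real A ≤ P.real {ω | (η ω).Finite ∧ ω ∈ A} := by
  refine ENNReal.toReal_mono (measure_ne_top _ _) (measure_mono_ae ?_)
  filter_upwards [hη.ae_finite] with ω hω hA
  exact ⟨hω, hA⟩

theorem measureReal_le_encard {Ω X : Type*} [MeasurableSpace Ω] [MeasurableSpace X] {P : Measure Ω}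
    [IsFiniteMeasure P] {η : Ω → Set X} {μ : Measure X} [IsFiniteMeasure μ]
    (hη : IsPoissonPointProcess P η μ) (k : ℕ) :
    P.real {ω | (k : ℕ∞) ≤ (η ω).encard} ≤ μ.real Set.univ ^ k / (k.factorial : ℝ) := by
  have h := hη.measure_le_encard MeasurableSet.univ (measure_ne_top _ _) k
  simp only [Set.inter_univ] at h
  have h2 := ENNReal.toReal_mono (ENNReal.div_ne_top (by finiteness)
    (by exact_mod_cast k.factorial_ne_zero)) h
  rwa [ENNReal.toReal_div, ENNReal.toReal_pow, ENNReal.toReal_natCast] at h2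

/-- Concentration of the edge count when the expected number of points is bounded, uniformly in
the connection radius. -/
theorem exists_concentration_of_measure_le (E : Type*) [NormedAddCommGroup E] [MeasurableSpace E]
    (T : ℝ) : ∃ c : ℝ, 0 < c ∧ ∀ (Ω : Type*) [MeasurableSpace Ω] (P : Measure Ω)
      [IsProbabilityMeasure P] (η : Ω → Set E) (μ : Measure E) [IsFiniteMeasure μ],
      IsPoissonPointProcess P η μ → μ.real Set.univ ≤ T → ∀ r m : ℝ,
      IsMedian P (fun ω => (gilbertEdgeCount (η ω) r : ℝ)) m → ∀ u : ℝ, c ≤ u / √(u + m) →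
        P.real {ω | u ≤ |(gilbertEdgeCount (η ω) r : ℝ) - m|}
          ≤ 4 * μ.real Set.univ * Real.exp (-(1 / 16 * (u / √(u + m)))) := by
  set T' := |T| + 1
  have hT' : 1 ≤ T' := by have := abs_nonneg T; linarith
  -- `k₁` bounds the median by `k₁ ^ 2`: a larger one would require at least `k₁` points with
  -- probability at least one half. `k₀` makes the Poisson tail at `k` smaller than `exp (-k)`.
  obtain ⟨k₁, hk₁⟩ := ((FloorSemiring.tendsto_pow_div_factorial_atTop T').eventually_lt_const
    (show (0 : ℝ) < 1 / 2 by norm_num)).exists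
  obtain ⟨k₀, hk₀⟩ := eventually_atTop.1 ((FloorSemiring.tendsto_pow_div_factorial_atTop
    (T' * Real.exp 1)).eventually_lt_const (show (0 : ℝ) < 1 by norm_num))
  refine ⟨k₀ + k₁ + 1, by positivity, fun Ω _ P _ η μ _ hη hμ r m hm u hu => ?_⟩
  set l := μ.real Set.univ
  set x := u / √(u + m)
  have hl0 : 0 ≤ l := measureReal_nonneg
  have hlT : l ≤ T' := hμ.trans ((le_abs_self T).trans (by linarith))
  have hm0 : 0 ≤ m := hm.nonneg fun _ => Nat.cast_nonneg _
  have hcard : ∀ (k : ℕ) (s : ℝ), (∀ n : ℕ, s ≤ (n : ℝ) ^ 2 → k ≤ n) →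
      P.real {ω | s ≤ (gilbertEdgeCount (η ω) r : ℝ)} ≤ l ^ k / (k.factorial : ℝ) := by
    intro k s hs
    refine (hη.measureReal_le_finite _).trans
      ((measureReal_mono ?_).trans (hη.measureReal_le_encard k))
    rintro ω ⟨hfin, hω⟩
    have h1 : s ≤ ((η ω).ncard : ℝ) ^ 2 :=
      le_trans hω (by exact_mod_cast gilbertEdgeCount_le_ncard_sq hfin r)
    change (k : ℕ∞) ≤ (η ω).encard
    rw [← hfin.cast_ncard_eq]
    exact_mod_cast hs _ h1
  have hmk : m ≤ (k₁ : ℝ) ^ 2 := by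
    by_contra! hc
    have h1 := hcard k₁ m fun n hn => by
      have h2 : (k₁ : ℝ) ^ 2 < (n : ℝ) ^ 2 := hc.trans_le hn
      exact_mod_cast (lt_of_pow_lt_pow_left₀ 2 (Nat.cast_nonneg n) h2).le
    have h3 : l ^ k₁ / (k₁.factorial : ℝ) ≤ T' ^ k₁ / (k₁.factorial : ℝ) := by gcongr
    linarith [hm.2]
  have hxpos : 0 < x := lt_of_lt_of_le (by positivity) hu
  have hu0 : 0 < u := pos_of_pos_div_sqrt hxpos
  have hxu : x ≤ √u := div_sqrt_le_sqrt hu0 hm0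
  have hx2 : x ^ 2 ≤ u := (Real.le_sqrt hxpos.le hu0.le).1 hxu
  -- As the edge count is nonnegative, downward deviations by `u` are now impossible.
  have hmu : m < u := by
    have h1 : (k₁ : ℝ) + 1 ≤ x := by linarith [Nat.cast_nonneg (α := ℝ) k₀]
    nlinarith [Nat.cast_nonneg (α := ℝ) k₁]
  have hsub : {ω | u ≤ |(gilbertEdgeCount (η ω) r : ℝ) - m|} ⊆
      {ω | u ≤ (gilbertEdgeCount (η ω) r : ℝ)} := by
    intro ω hω
    have h0 : (0 : ℝ) ≤ gilbertEdgeCount (η ω) r := Nat.cast_nonneg _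
    rcases le_abs.1 (show u ≤ |(gilbertEdgeCount (η ω) r : ℝ) - m| from hω) with h | h
    · change u ≤ _; linarith
    · linarith
  set k := ⌈x⌉₊
  have hxk : x ≤ k := Nat.le_ceil x
  have hk : k₀ + k₁ + 1 ≤ k := by
    have : ((k₀ + k₁ + 1 : ℕ) : ℝ) ≤ k := by push_cast; linarith
    exact_mod_cast this
  have h1 := hcard k u fun n hn => Nat.ceil_le.2 <|
    le_of_sq_le_sq (hx2.trans hn) (Nat.cast_nonneg n)
  -- One factor `l` is kept, since the bound must be linear in the mass even when the mass is small.
  have h2 : l ^ k ≤ l * T' ^ k := by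
    obtain ⟨j, hj⟩ : ∃ j, k = j + 1 := ⟨k - 1, by omega⟩
    rw [hj, pow_succ' l]
    gcongr
    calc l ^ j ≤ T' ^ j := by gcongr
      _ ≤ T' ^ (j + 1) := pow_le_pow_right₀ hT' (Nat.le_succ j)
  have h3 : T' ^ k / (k.factorial : ℝ) ≤ Real.exp (-(1 / 16 * x)) := by
    have h4 := (hk₀ k (by omega)).le
    rw [mul_pow, ← Real.exp_nat_mul, mul_one] at h4
    calc T' ^ k / (k.factorial : ℝ)
        = (T' ^ k * Real.exp k / (k.factorial : ℝ)) * Real.exp (-(k : ℝ)) := by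
          rw [Real.exp_neg]; field_simp
      _ ≤ 1 * Real.exp (-(k : ℝ)) := by gcongr
      _ ≤ Real.exp (-(1 / 16 * x)) := by
          rw [one_mul]; exact Real.exp_le_exp.2 (by linarith)
  calc _ ≤ l ^ k / (k.factorial : ℝ) := (measureReal_mono hsub).trans h1
    _ ≤ l * T' ^ k / (k.factorial : ℝ) := by gcongr
    _ = l * (T' ^ k / (k.factorial : ℝ)) := by ring
    _ ≤ l * Real.exp (-(1 / 16 * x)) := by gcongr
    _ ≤ _ := by nlinarith [mul_nonneg hl0 (Real.exp_nonneg (-(1 / 16 * x)))]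

/-- Concentration of the edge count when the intensity measure has total mass at least one and the
cubes of side `r` have bounded mass. -/
theorem exists_concentration_of_cube_le (d : ℕ) (K : ℝ) : ∃ c : ℝ, 0 < c ∧
    ∀ (Ω : Type*) [MeasurableSpace Ω] (P : Measure Ω) [IsProbabilityMeasure P]
      (η : Ω → Set (EuclideanSpace ℝ (Fin d))) (μ : Measure (EuclideanSpace ℝ (Fin d)))
      [IsFiniteMeasure μ], IsPoissonPointProcess P η μ → 1 ≤ μ.real Set.univ →
      ∀ r : ℝ, 0 < r → (∀ z, μ (cubeIndex r ⁻¹' {z}) ≤ ENNReal.ofReal K) →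
      ∀ m : ℝ, IsMedian P (fun ω => (gilbertEdgeCount (η ω) r : ℝ)) m →
      ∀ u : ℝ, c ≤ u / √(u + m) →
        P.real {ω | u ≤ |(gilbertEdgeCount (η ω) r : ℝ) - m|}
          ≤ 4 * μ.real Set.univ * Real.exp (-(1 / 16 * (u / √(u + m)))) := by
  set L := (ENNReal.ofReal K).toReal
  obtain ⟨c, hc16, hc⟩ := exists_pow_div_factorial_le_exp (2 * 3 ^ d) L (by positivity)
  refine ⟨c, by linarith, fun Ω _ P _ η μ _ hη hμ r hr hcube m hm u hu => ?_⟩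
  obtain ⟨hk1, hk2⟩ := hc _ hu
  set l := μ.real Set.univ
  set x := u / √(u + m) with hx
  set k := ⌊x / (2 * 3 ^ d)⌋₊ with hk
  set f : Ω → ℝ := fun ω => (gilbertEdgeCount (η ω) r : ℝ) with hf
  set Bad : Set Ω := {ω | ∃ z, ((k + 1 : ℕ) : ℕ∞) ≤ (η ω ∩ cubeIndex r ⁻¹' {z}).encard} with hBad
  have hxpos : 0 < x := by linarith
  have hu0 : 0 < u := pos_of_pos_div_sqrt hxpos
  have hm0 : 0 ≤ m := hm.nonneg fun _ => Nat.cast_nonneg _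
  have hx2 : x ^ 2 = u ^ 2 / (u + m) := by rw [hx, div_pow, Real.sq_sqrt (by linarith)]
  have hDpos : 0 < 3 ^ d * k := by positivity
  have hDpos' : (0 : ℝ) < (3 ^ d * k : ℕ) := by exact_mod_cast hDpos
  have hDx : ((3 ^ d * k : ℕ) : ℝ) ≤ x / 2 := by
    have h1 : (k : ℝ) ≤ x / (2 * 3 ^ d) := Nat.floor_le (by positivity)
    rw [le_div_iff₀ (by positivity)] at h1
    push_cast
    linarith
  -- With degree bound `3 ^ d * k ≤ x / 2` and `b ≤ u + m`, Talagrand's exponent is at least `x ^ 2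
  -- / (8 * x) = x / 8`.
  set q := Real.exp (-(x / 8)) with hq
  have hprod : ∀ a b : ℝ, 0 ≤ a → b - a = u → b ≤ u + m →
      P.real {ω | (η ω).Finite ∧ f ω ≤ a} * P.real {ω | (η ω).Finite ∧ b ≤ f ω ∧
        ∀ y ∈ η ω, (η ω ∩ Metric.closedBall y r).encard ≤ (3 ^ d * k : ℕ)} ≤ q := by
    intro a b ha hba hbm
    refine (hη.gilbertEdgeCount_mul_le r ha (by linarith) hDpos).trans (Real.exp_le_exp.2 ?_)
    rw [hba, neg_le_neg_iff]
    have hb : 0 < b := by linarith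
    calc x / 8 = x ^ 2 / (16 * (x / 2)) := by field_simp; norm_num
      _ ≤ x ^ 2 / (16 * (3 ^ d * k : ℕ)) := by gcongr
      _ = u ^ 2 / (16 * (3 ^ d * k : ℕ) * (u + m)) := by rw [hx2, div_div, mul_comm (u + m)]
      _ ≤ u ^ 2 / (16 * (3 ^ d * k : ℕ) * b) := by gcongr
  have hp : P.real Bad ≤ l * (L ^ k / (k.factorial : ℝ)) := by
    have h1 := ENNReal.toReal_mono (ENNReal.mul_ne_top (measure_ne_top _ _)
      (ENNReal.div_ne_top (by finiteness) (by exact_mod_cast k.factorial_ne_zero)))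
      (hη.measure_exists_cell_le (measurable_cubeIndex r) hcube k)
    rwa [ENNReal.toReal_mul, ENNReal.toReal_div, ENNReal.toReal_pow, ENNReal.toReal_natCast] at h1
  have hgood : ∀ b : ℝ, P.real {ω | b ≤ f ω} ≤ P.real {ω | (η ω).Finite ∧ b ≤ f ω ∧
      ∀ y ∈ η ω, (η ω ∩ Metric.closedBall y r).encard ≤ (3 ^ d * k : ℕ)} + P.real Bad := by
    intro b
    refine (hη.measureReal_le_finite _).trans ((measureReal_mono ?_).trans
      (measureReal_union_le _ _))
    rintro ω ⟨hfin, hω⟩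
    by_cases hB : ω ∈ Bad
    · exact Or.inr hB
    · refine Or.inl ⟨hfin, hω, fun y _ => encard_inter_closedBall_le hr (fun z => ?_) y⟩
      by_contra! hlt
      refine hB ⟨z, ?_⟩
      push_cast
      exact Order.add_one_le_of_lt hlt
  have hle1 : ∀ A : Set Ω, P.real A ≤ 1 := fun A => measureReal_le_one
  have hnn : ∀ A : Set Ω, 0 ≤ P.real A := fun A => measureReal_nonneg
  have hupper : P.real {ω | m + u ≤ f ω} ≤ 2 * q + P.real Bad := by
    have h1 := hprod m (m + u) hm0 (by ring) (by linarith)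
    have h2 : 1 / 2 ≤ P.real {ω | (η ω).Finite ∧ f ω ≤ m} :=
      hm.1.trans (hη.measureReal_le_finite _)
    nlinarith [hgood (m + u), mul_le_mul_of_nonneg_right h2 (hnn {ω | (η ω).Finite ∧ m + u ≤ f ω ∧
      ∀ y ∈ η ω, (η ω ∩ Metric.closedBall y r).encard ≤ (3 ^ d * k : ℕ)})]
  have hlower : P.real {ω | f ω ≤ m - u} ≤ 2 * q + 2 * P.real Bad := by
    rcases lt_or_ge m u with hmu | hmu
    · have : {ω | f ω ≤ m - u} = ∅ := by
        ext ω
        simp only [Set.mem_ofPred_eq, Set.mem_empty_iff_false, iff_false, not_le]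
        have : (0 : ℝ) ≤ f ω := Nat.cast_nonneg _
        linarith
      rw [this, measureReal_empty]
      have := Real.exp_pos (-(x / 8))
      linarith [hnn Bad]
    · have h1 := hprod (m - u) m (by linarith) (by ring) (by linarith)
      have h2 := hη.measureReal_le_finite {ω | f ω ≤ m - u}
      have h3 := hm.2.trans (hgood m)
      -- The degree restriction now falls on the event at the median, leaving probability at least
      -- `1 / 2 - P.real Bad`. Expanding the product instead of dividing avoids asking that this be
      -- positive.
      have h4 : P.real {ω | (η ω).Finite ∧ f ω ≤ m - u} * (1 / 2 - P.real Bad) ≤ q :=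
        (mul_le_mul_of_nonneg_left (by linarith) (hnn _)).trans h1
      have h5 := mul_le_mul_of_nonneg_right (hle1 {ω | (η ω).Finite ∧ f ω ≤ m - u}) (hnn Bad)
      change P.real {ω | f ω ≤ m - u} ≤ P.real {ω | (η ω).Finite ∧ f ω ≤ m - u} at h2
      linarith
  have htot : P.real {ω | u ≤ |f ω - m|} ≤ 4 * q + 3 * P.real Bad := by
    have hsub : {ω | u ≤ |f ω - m|} ⊆ {ω | m + u ≤ f ω} ∪ {ω | f ω ≤ m - u} := by
      intro ω hω
      rcases le_abs.1 (show u ≤ |f ω - m| from hω) with h | h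
      · left; change m + u ≤ f ω; linarith
      · right; change f ω ≤ m - u; linarith
    linarith [(measureReal_mono hsub (μ := P)).trans (measureReal_union_le _ _)]
  -- Half of the final factor 4 pays for `4 * q`, using mass at least one, and the other half for `3
  -- * P.real Bad`.
  have hq2 : q ≤ Real.exp (-(x / 16)) * (1 / 2) := by
    have h1 : q = Real.exp (-(x / 16)) * Real.exp (-(x / 16)) := by
      rw [hq, ← Real.exp_add]; congr 1; ring
    rw [h1]
    gcongr
    calc Real.exp (-(x / 16)) ≤ Real.exp (-1) := Real.exp_le_exp.2 (by linarith)
      _ ≤ 1 / 2 := by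
        rw [Real.exp_neg, ← one_div]
        exact one_div_le_one_div_of_le (by norm_num) (by linarith [Real.add_one_le_exp 1])
  have he : Real.exp (-(1 / 16 * x)) = Real.exp (-(x / 16)) := by congr 1; ring
  rw [he]
  have hpos := Real.exp_pos (-(x / 16))
  nlinarith [mul_le_mul_of_nonneg_left hk2 (show 0 ≤ l by linarith),
    mul_le_mul_of_nonneg_right hμ hpos.le]

end IsPoissonPointProcess

/-! ### The restricted Lebesgue intensity and the theorem -/

theorem smul_restrict_real_univ {X : Type*} [MeasurableSpace X] (ν : Measure X) (W : Set X) {t : ℝ}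
    (ht : 0 < t) : (ENNReal.ofReal t • ν.restrict W).real Set.univ = t * ν.real W := by
  simp [measureReal_def, ENNReal.toReal_ofReal ht.le]

theorem smul_volume_restrict_cube_le {d : ℕ} (W : Set (EuclideanSpace ℝ (Fin d))) {t r K : ℝ}
    (ht : 0 < t) (hr : 0 < r) (hK : t * r ^ d ≤ K) (z : Fin d → ℤ) :
    (ENNReal.ofReal t • volume.restrict W) (cubeIndex r ⁻¹' {z}) ≤ ENNReal.ofReal K := by
  rw [Measure.smul_apply, smul_eq_mul]
  refine le_trans (mul_le_mul_right (Measure.restrict_apply_le _ _) _) ?_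
  rw [volume_cubeIndex_preimage hr, ← ENNReal.ofReal_mul ht.le]
  exact ENNReal.ofReal_le_ofReal hK

theorem mainTheorem7 (d : ℕ) (hd : 1 ≤ d) :
    -- for every family `δ` in the thermodynamic regime there is a constant valid for all `t > 0`
    (∀ (δ : ℝ → ℝ) (γ : ℝ), (∀ t, 0 < t → 0 < δ t) → Tendsto δ atTop (𝓝 0) →
      Tendsto (fun t => t * δ t ^ d) atTop (𝓝 γ) →
      ∃ c : ℝ, 0 < c ∧
        ∀ W : Set (EuclideanSpace ℝ (Fin d)), IsCompact W → Convex ℝ W → volume W = 1 →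
        ∀ t : ℝ, 0 < t →
        ∀ (Ω : Type*) [MeasurableSpace Ω] (P : Measure Ω) [IsProbabilityMeasure P]
          (η : Ω → Set (EuclideanSpace ℝ (Fin d))),
          IsPoissonPointProcess P η (ENNReal.ofReal t • volume.restrict W) →
        ∀ m : ℝ, IsMedian P (fun ω => (gilbertEdgeCount (η ω) (δ t) : ℝ)) m →
        ∀ u : ℝ, c ≤ u / √(u + m) →
          P.real {ω | u ≤ |(gilbertEdgeCount (η ω) (δ t) : ℝ) - m|}
            ≤ 4 * t * volume.real W * Real.exp (-(1 / 16 * (u / √(u + m))))) ∧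
    -- the constant depends only on `d` and on an upper bound `K` for `t * δ ^ d`
    (∀ K : ℝ, ∃ c : ℝ, 0 < c ∧
        ∀ W : Set (EuclideanSpace ℝ (Fin d)), IsCompact W → Convex ℝ W → volume W = 1 →
        ∀ t r : ℝ, 0 < t → 0 < r → t * r ^ d ≤ K →
        ∀ (Ω : Type*) [MeasurableSpace Ω] (P : Measure Ω) [IsProbabilityMeasure P]
          (η : Ω → Set (EuclideanSpace ℝ (Fin d))),
          IsPoissonPointProcess P η (ENNReal.ofReal t • volume.restrict W) →
        ∀ m : ℝ, IsMedian P (fun ω => (gilbertEdgeCount (η ω) r : ℝ)) m →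
        ∀ u : ℝ, c ≤ u / √(u + m) →
          P.real {ω | u ≤ |(gilbertEdgeCount (η ω) r : ℝ) - m|}
            ≤ 4 * t * volume.real W * Real.exp (-(1 / 16 * (u / √(u + m))))) := by 
  have hfin : ∀ (W : Set (EuclideanSpace ℝ (Fin d))) (t : ℝ), volume W = 1 →
      IsFiniteMeasure (ENNReal.ofReal t • volume.restrict W) := fun W t hW => by
    have : IsFiniteMeasure (volume.restrict W) :=
      isFiniteMeasure_restrict.2 (by rw [hW]; exact ENNReal.one_ne_top)
    exact Measure.smul_finite _ ENNReal.ofReal_ne_top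
  have hmass : ∀ (W : Set (EuclideanSpace ℝ (Fin d))) (t : ℝ), volume W = 1 → 0 < t →
      (ENNReal.ofReal t • volume.restrict W).real Set.univ = t := fun W t hW ht => by
    rw [smul_restrict_real_univ _ _ ht, measureReal_def, hW, ENNReal.toReal_one, mul_one]
  constructor
  · intro δ γ hδ _ hγ
    -- Convergence bounds `t * δ t ^ d` only for `t ≥ T`. Below `max T 1` nothing is known about the
    -- radius, which is why the bounded-mass estimate is uniform in it.
    obtain ⟨T, hT⟩ := eventually_atTop.1 (hγ.eventually_le_const (lt_add_one γ))
    obtain ⟨c₁, hc₁, h₁⟩ := IsPoissonPointProcess.exists_concentration_of_measure_le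
      (EuclideanSpace ℝ (Fin d)) (max T 1)
    obtain ⟨c₂, hc₂, h₂⟩ := IsPoissonPointProcess.exists_concentration_of_cube_le d (γ + 1)
    refine ⟨max c₁ c₂, lt_max_of_lt_left hc₁, fun W _ _ hW t ht Ω _ P _ η hη m hm u hu => ?_⟩
    have := hfin W t hW
    rw [mul_assoc 4 t, ← smul_restrict_real_univ _ _ ht]
    rcases le_total t (max T 1) with h | h
    · exact h₁ Ω P η _ hη (by rwa [hmass W t hW ht]) _ m hm u ((le_max_left _ _).trans hu)
    · exact h₂ Ω P η _ hη (by rw [hmass W t hW ht]; exact (le_max_right _ _).trans h) _ (hδ t ht)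
        (smul_volume_restrict_cube_le W ht (hδ t ht) (hT t ((le_max_left _ _).trans h))) m hm u
        ((le_max_right _ _).trans hu)
  · intro K
    obtain ⟨c₁, hc₁, h₁⟩ := IsPoissonPointProcess.exists_concentration_of_measure_le
      (EuclideanSpace ℝ (Fin d)) 1
    obtain ⟨c₂, hc₂, h₂⟩ := IsPoissonPointProcess.exists_concentration_of_cube_le d K
    refine ⟨max c₁ c₂, lt_max_of_lt_left hc₁,
      fun W _ _ hW t r ht hr hK Ω _ P _ η hη m hm u hu => ?_⟩
    have := hfin W t hW
    rw [mul_assoc 4 t, ← smul_restrict_real_univ _ _ ht]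
    rcases le_total t 1 with h | h
    · exact h₁ Ω P η _ hη (by rwa [hmass W t hW ht]) _ m hm u ((le_max_left _ _).trans hu)
    · exact h₂ Ω P η _ hη (by rwa [hmass W t hW ht]) _ hr
        (smul_volume_restrict_cube_le W ht hr hK) m hm u ((le_max_right _ _).trans hu)
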